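/- Let $\mathcal H$ be a finite-dimensional complex Hilbert space and let $\Phi:\mathcal B(\mathcal H)\to\mathcal B(\mathcal H)$ be a quantum channel, i.e. a completely positive, trace-preserving linear map. Let $$\mathrm{Attr}(\Phi)=\bigoplus_{\lambda\in\mathbb C,\ |\lambda|=1}\ker(\Phi-\lambda\,\mathsf 1)$$ be its attractor subspace, which is invariant under $\Phi$, and let $\Phi_P=\Phi|_{\mathrm{Attr}(\Phi)}$ be the peripheral map. 1. If $\Phi=e^{\mathcal L}$ for some GKLS (Lindblad) generator $\mathcal L$, i.e. a map of the form $$\mathcal L(X)=-\mathrm i[K,X]+\sum_{j=1}^{m}\Bigl(A_jXA_j^\dagger-\tfrac12\bigl(A_j^\dagger A_jX+XA_j^\dagger A_j\bigr)\Bigr)$$ with $K=K^\dagger$ and $A_1,\dots,A_m\in\mathcal B(\mathcal H)$, $m\ge 0$, then there is a unitary operator $U$ on $\mathcal H$ such that $\Phi_P(X)=UXU^\dagger$ for all $X\in\mathrm{Attr}(\Phi)$. 2. If $\Phi^2=\Phi$, then there is a unitary operator $U$ on $\mathcal H$ such that $\Phi_P(X)=UXU^\dagger$ for all $X\in\mathrm{Attr}(\Phi)$.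 -/

import Mathlib

open scoped CStarAlgebra

/-- A quantum channel (Schrödinger picture) on the bounded operators of a
finite-dimensional Hilbert space `H`: a completely positive linear map that preserves the trace. -/
structure QuantumChannel (H : Type*) [NormedAddCommGroup H] [InnerProductSpace ℂ H]
    [CompleteSpace H] [FiniteDimensional ℂ H] extends (H →L[ℂ] H) →CP (H →L[ℂ] H) where
  trace_map' (X : H →L[ℂ] H) :
    LinearMap.trace ℂ H (toLinearMap X).toLinearMap = LinearMap.trace ℂ H X.toLinearMap

/-- `L` is a GKLS (Lindblad) generator: for some self-adjoint `K` and some finite family of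
noise operators `A j`,
`L X = -i [K, X] + ∑ j, (A j X (A j)† - (1/2) ((A j)† A j X + X (A j)† A j))`. -/
def IsGKLSGenerator {H : Type*} [NormedAddCommGroup H] [InnerProductSpace ℂ H] [CompleteSpace H]
    (L : (H →L[ℂ] H) →L[ℂ] (H →L[ℂ] H)) : Prop :=
  ∃ (K : H →L[ℂ] H) (m : ℕ) (A : Fin m → (H →L[ℂ] H)), IsSelfAdjoint K ∧
    ∀ X : H →L[ℂ] H, L X = -(Complex.I • (K * X - X * K)) +
      ∑ j, (A j * X * star (A j) -
        (1 / 2 : ℂ) • (star (A j) * A j * X + X * (star (A j) * A j)))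

namespace QuantumChannel

variable {H : Type*} [NormedAddCommGroup H] [InnerProductSpace ℂ H] [CompleteSpace H]
  [FiniteDimensional ℂ H]

/-- The attractor subspace of a channel: the sum of its eigenspaces for the eigenvalues of modulus
one (a direct sum, since eigenspaces for distinct eigenvalues are independent). -/
noncomputable def attractor (Φ : QuantumChannel H) : Submodule ℂ (H →L[ℂ] H) :=
  ⨆ (z : ℂ) (_ : ‖z‖ = 1), Module.End.eigenspace Φ.toLinearMap z

theorem map_mem_attractor (Φ : QuantumChannel H) :
    ∀ X ∈ Φ.attractor, Φ.toLinearMap X ∈ Φ.attractor := by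
  change Φ.attractor ≤ Φ.attractor.comap Φ.toLinearMap
  refine iSup₂_le fun z hz X hX => ?_
  have hX' : Φ.toLinearMap X = z • X := Module.End.mem_eigenspace_iff.mp hX
  rw [Submodule.mem_comap, hX']
  exact Φ.attractor.smul_mem z
    (le_iSup₂ (f := fun (z : ℂ) (_ : ‖z‖ = 1) => Module.End.eigenspace Φ.toLinearMap z) z hz hX)

/-- The peripheral map: the restriction of a channel to its attractor subspace. -/
noncomputable def peripheralMap (Φ : QuantumChannel H) : Φ.attractor →ₗ[ℂ] Φ.attractor :=
  Φ.toLinearMap.restrict Φ.map_mem_attractor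

end QuantumChannel

/-!
# Peripheral maps of Markovian and of idempotent channels are unitary conjugations

If `Φ` is idempotent, its only eigenvalue of modulus one is `1`, so `Φ` is the identity on the
attractor subspace and `U = 1` works.

Let `Φ = exp L` with `L X = G X + X Gᴴ + ∑ j, A j X (A j)ᴴ` and `G + Gᴴ + ∑ j, (A j)ᴴ A j = 0`.
Eigenvectors of `exp L` for an eigenvalue of modulus one are sums of eigenvectors of `L` with purely
imaginary eigenvalues (`ContinuousLinearMap.eigenspace_exp_le`). It is therefore enough to find a
Hermitian `h` such that `L X = i ω X` implies `-i [h, X] = i ω X`: then `U = exp (-i h)` works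
(`exp_mul_mul_exp_of_commutator`). After choosing an orthonormal basis this is a statement about
matrices, `Matrix.exists_hermitian_of_gkls`.

Suppose first that there is a positive definite `ρ` with `L ρ = 0`. If `L (x ρ) = i ω x ρ`, the
dissipation identity `Matrix.sum_commutator_mul_conjTranspose`, for `L` and then for its trace dual,
shows that `x` commutes with all `A j` and `(A j)ᴴ`, and that `[K, x] = -ω x` for the Hamiltonian `K`
(`Matrix.commute_of_eigenvector`). Such `x` lie in the decoherence-free algebra `N`, a
`*`-subalgebra on which `[K, ·]` is a derivation. The Hilbert–Schmidt projection `h` of `K` onto `N`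
implements this derivation (`Matrix.exists_hermitian_mem_commutator_eq`), and `h` commutes with
`ρ`; hence `[h, x ρ] = -ω x ρ`.

In general, a stationary `ρ ≥ 0` with kernel of minimal dimension supports every peripheral
eigenvector (`Matrix.exists_maximal_stationary`). Its support is invariant under `G` and all `A j`,
so compressing `L` to it does not change `L` on peripheral eigenvectors, and it makes the positive
definite matrix `ρ + Q` stationary, where `Q` is the projection onto the kernel of `ρ`. That
peripheral eigenvectors are dominated by stationary states follows from the corresponding fact for
Hermitian fixed points of positive trace-preserving maps
(`Matrix.exists_posSemidef_fixed_of_hermitian_fixed`): an implicit Euler step turns the equation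
`L X = 0` into a fixed-point equation of such a map, and a `2 × 2` block construction removes the
phase `i ω`.
-/

/-! ### Positive semidefinite matrices and positive trace-preserving maps -/

namespace Matrix

open scoped ComplexOrder

variable {n ι : Type*} [Fintype n] [Fintype ι]

theorem PosSemidef.mulVec_eq_zero_of_add {ρ σ : Matrix n n ℂ} (hρ : ρ.PosSemidef)
    (hσ : σ.PosSemidef) {v : n → ℂ} (hv : (ρ + σ) *ᵥ v = 0) : ρ *ᵥ v = 0 := by
  classical
  rw [← hρ.dotProduct_mulVec_zero_iff]
  have h1 := hρ.dotProduct_mulVec_nonneg v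
  have h2 := hσ.dotProduct_mulVec_nonneg v
  have h3 : star v ⬝ᵥ (ρ *ᵥ v) + star v ⬝ᵥ (σ *ᵥ v) = 0 := by
    rw [← dotProduct_add, ← add_mulVec, hv, dotProduct_zero]
  exact ((add_eq_zero_iff_of_nonneg h1 h2).1 h3).1

theorem mul_eq_zero_of_mulVec {ρ X Y : Matrix n n ℂ}
    (h : ∀ v, ρ *ᵥ v = 0 → X *ᵥ v = 0) (hY : ρ * Y = 0) : X * Y = 0 := by
  classical
  apply Matrix.ext_of_mulVec_single
  intro i
  rw [← mulVec_mulVec, zero_mulVec]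
  apply h
  rw [mulVec_mulVec, hY, zero_mulVec]

theorem IsHermitian.exists_eq_unitary_conj_diagonal [DecidableEq n] {Y : Matrix n n ℂ}
    (hY : Y.IsHermitian) :
    ∃ (U : Matrix n n ℂ) (l : n → ℝ), Uᴴ * U = 1 ∧
      Y = U * diagonal (fun i => (l i : ℂ)) * Uᴴ := by
  refine ⟨hY.eigenvectorUnitary, hY.eigenvalues, ?_, ?_⟩
  · rw [← star_eq_conjTranspose]
    exact Unitary.coe_star_mul_self hY.eigenvectorUnitary
  · have h := hY.spectral_theorem
    rw [Unitary.conjStarAlgAut_apply] at h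
    exact h

theorem conj_diagonal_mul_conj_diagonal [DecidableEq n] {U : Matrix n n ℂ} (hU : Uᴴ * U = 1)
    (a b : n → ℂ) :
    (U * diagonal a * Uᴴ) * (U * diagonal b * Uᴴ) = U * diagonal (fun i => a i * b i) * Uᴴ := by
  rw [← diagonal_mul_diagonal]
  calc _ = U * diagonal a * (Uᴴ * U) * diagonal b * Uᴴ := by simp only [Matrix.mul_assoc]
    _ = _ := by rw [hU]; simp only [Matrix.mul_assoc, Matrix.one_mul]

theorem isHermitian_conj_diagonal_ite [DecidableEq n] (U : Matrix n n ℂ) (p : n → Prop)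
    [DecidablePred p] : (U * diagonal (fun i => if p i then (1 : ℂ) else 0) * Uᴴ).IsHermitian := by
  refine isHermitian_mul_mul_conjTranspose U (isHermitian_diagonal_iff.2 fun i => ?_)
  split_ifs <;> simp [IsSelfAdjoint]

/-- Jordan decomposition `Y = Yp - Ym` of a Hermitian matrix, together with the support projection
`P` of the positive part. -/
theorem IsHermitian.exists_pos_neg_parts [DecidableEq n] {Y : Matrix n n ℂ} (hY : Y.IsHermitian) :
    ∃ Yp Ym P : Matrix n n ℂ, Yp.PosSemidef ∧ Ym.PosSemidef ∧ Y = Yp - Ym ∧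
      P.IsHermitian ∧ P * P = P ∧ P * Yp = Yp ∧ P * Ym = 0 := by
  obtain ⟨U, l, hU, hYU⟩ := hY.exists_eq_unitary_conj_diagonal
  refine ⟨U * diagonal (fun i => ((max (l i) 0 : ℝ) : ℂ)) * Uᴴ,
    U * diagonal (fun i => ((max (-l i) 0 : ℝ) : ℂ)) * Uᴴ,
    U * diagonal (fun i => if 0 < l i then 1 else 0) * Uᴴ, ?_, ?_, ?_,
    isHermitian_conj_diagonal_ite U _, ?_, ?_, ?_⟩
  · exact (PosSemidef.diagonal fun i => by simp).mul_mul_conjTranspose_same U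
  · exact (PosSemidef.diagonal fun i => by simp).mul_mul_conjTranspose_same U
  · rw [← sub_mul, ← mul_sub, diagonal_sub, hYU]
    congr 3
    ext i
    rw [← Complex.ofReal_sub]
    congr 1
    rcases le_total 0 (l i) with h | h <;> simp [h]
  · rw [conj_diagonal_mul_conj_diagonal hU]; congr 3; ext i; split_ifs <;> simp
  · rw [conj_diagonal_mul_conj_diagonal hU]; congr 3; ext i; split_ifs with h
    · simp
    · simp [max_eq_right (not_lt.1 h)]
  · have : (fun i => (if 0 < l i then (1 : ℂ) else 0) * ((max (-l i) 0 : ℝ) : ℂ)) = 0 := by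
      ext i; split_ifs with h
      · simp [max_eq_right (neg_nonpos.2 h.le)]
      · simp
    rw [conj_diagonal_mul_conj_diagonal hU, this]; simp

/-- The orthogonal projection `Q` onto the kernel of a positive semidefinite matrix. -/
theorem PosSemidef.exists_kernel_projection [DecidableEq n] {ρ : Matrix n n ℂ}
    (hρ : ρ.PosSemidef) :
    ∃ Q : Matrix n n ℂ, Q.IsHermitian ∧ Q * Q = Q ∧ ρ * Q = 0 ∧ (ρ + Q).PosDef := by
  obtain ⟨U, l, hU, hYU⟩ := hρ.1.exists_eq_unitary_conj_diagonal
  have hl : ∀ i, 0 ≤ l i := by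
    have h : (diagonal (fun i => (l i : ℂ))).PosSemidef := by
      have h := hρ.conjTranspose_mul_mul_same U
      have e : Uᴴ * ρ * U = diagonal (fun i => (l i : ℂ)) := by
        calc Uᴴ * ρ * U = (Uᴴ * U) * diagonal (fun i => (l i : ℂ)) * (Uᴴ * U) := by
              rw [hYU]; simp only [Matrix.mul_assoc]
          _ = _ := by rw [hU, Matrix.one_mul, Matrix.mul_one]
      rwa [e] at h
    intro i
    exact_mod_cast posSemidef_diagonal_iff.1 h i
  refine ⟨U * diagonal (fun i => if l i = 0 then 1 else 0) * Uᴴ,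
    isHermitian_conj_diagonal_ite U _, ?_, ?_, ?_⟩
  · rw [conj_diagonal_mul_conj_diagonal hU]; congr 3; ext i; split_ifs <;> simp
  · have : (fun i => (l i : ℂ) * (if l i = 0 then (1 : ℂ) else 0)) = 0 := by
      ext i; split_ifs with h <;> simp [h]
    rw [hYU, conj_diagonal_mul_conj_diagonal hU, this]; simp
  · nth_rw 1 [hYU]
    rw [← add_mul, ← mul_add, diagonal_add]
    refine PosDef.mul_mul_conjTranspose_same (PosDef.diagonal fun i => ?_)
      (vecMul_injective_of_isUnit (IsUnit.of_mul_eq_one_right _ hU))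
    split_ifs with h
    · simp [h]
    · simpa using lt_of_le_of_ne (hl i) (Ne.symm h)

theorem PosSemidef.mul_eq_zero_of_conj_eq_zero {σ B : Matrix n n ℂ} (hσ : σ.PosSemidef)
    (h : Bᴴ * σ * B = 0) : σ * B = 0 := by
  classical
  apply Matrix.ext_of_mulVec_single
  intro i
  rw [← mulVec_mulVec, zero_mulVec, ← hσ.dotProduct_mulVec_zero_iff]
  have := congrArg (fun M : Matrix n n ℂ => star (Pi.single i (1 : ℂ)) ⬝ᵥ (M *ᵥ Pi.single i 1)) h
  simp only [zero_mulVec, dotProduct_zero] at this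
  rw [← this, star_mulVec, ← dotProduct_mulVec, mulVec_mulVec, mulVec_mulVec, Matrix.mul_assoc]

theorem PosDef.eq_zero_of_sum_trace_eq_zero [DecidableEq n] {ρ : Matrix n n ℂ} (hρ : ρ.PosDef)
    {D : ι → Matrix n n ℂ} (h : (∑ j, D j * ρ * (D j)ᴴ).trace = 0) (j : ι) : D j = 0 := by
  have hp : ∀ j, (D j * ρ * (D j)ᴴ).PosSemidef := fun j =>
    hρ.posSemidef.mul_mul_conjTranspose_same _
  rw [trace_sum, Finset.sum_eq_zero_iff_of_nonneg fun j _ => (hp j).trace_nonneg] at h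
  have h0 := (hp j).trace_eq_zero_iff.1 (h j (Finset.mem_univ j))
  have h1 : ρ * (D j)ᴴ = 0 :=
    hρ.posSemidef.mul_eq_zero_of_conj_eq_zero (by rwa [conjTranspose_conjTranspose])
  rwa [hρ.isUnit.mul_right_eq_zero, conjTranspose_eq_zero] at h1

theorem trace_mul_eq_zero_of_projection {P σ : Matrix n n ℂ} (hP : P.IsHermitian) (hPP : P * P = P)
    (hσ : σ.PosSemidef) (h : (P * σ).trace ≤ 0) : P * σ = 0 := by
  have h1 : (Pᴴ * σ * P).PosSemidef := hσ.conjTranspose_mul_mul_same P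
  have h2 : (Pᴴ * σ * P).trace = (P * σ).trace := by
    rw [hP.eq, trace_mul_comm, ← Matrix.mul_assoc, hPP]
  have h3 : Pᴴ * σ * P = 0 := h1.trace_eq_zero_iff.1 (le_antisymm (h2 ▸ h) h1.trace_nonneg)
  have h4 : σ * P = 0 := hσ.mul_eq_zero_of_conj_eq_zero h3
  have h5 := congrArg conjTranspose h4
  rwa [conjTranspose_mul, hP.eq, hσ.1.eq, conjTranspose_zero] at h5

/-- A Hermitian fixed point of a positive trace-preserving map is dominated by a positive
semidefinite fixed point: both parts of its Jordan decomposition are fixed. -/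
theorem exists_posSemidef_fixed_of_hermitian_fixed [DecidableEq n]
    (T : Matrix n n ℂ →ₗ[ℂ] Matrix n n ℂ) (hT : ∀ X, X.PosSemidef → (T X).PosSemidef)
    (htr : ∀ X, (T X).trace = X.trace) {Y : Matrix n n ℂ} (hY : Y.IsHermitian) (hTY : T Y = Y) :
    ∃ σ : Matrix n n ℂ, σ.PosSemidef ∧ T σ = σ ∧ ∀ v, σ *ᵥ v = 0 → Y *ᵥ v = 0 := by
  obtain ⟨Yp, Ym, P, hp, hm, hYe, hP, hPP, hPp, hPm⟩ := hY.exists_pos_neg_parts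
  have hTd : T Yp - T Ym = Yp - Ym := by rw [← map_sub, ← hYe, hTY]
  have hpos : ∀ σ : Matrix n n ℂ, σ.PosSemidef → ∀ R : Matrix n n ℂ, R.IsHermitian → R * R = R →
      0 ≤ (R * σ).trace := by
    intro σ hσ R hR hRR
    have h2 : (Rᴴ * σ * R).trace = (R * σ).trace := by
      rw [hR.eq, trace_mul_comm, ← Matrix.mul_assoc, hRR]
    rw [← h2]
    exact (hσ.conjTranspose_mul_mul_same R).trace_nonneg
  have hQ : (1 - P).IsHermitian := isHermitian_one.sub hP
  have hQQ : (1 - P) * (1 - P) = 1 - P := by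
    simp [sub_mul, mul_sub, hPP]
  have hPT : P * T Yp = Yp + P * T Ym := by
    have := congrArg (P * ·) hTd
    simp only [mul_sub, hPp, hPm, sub_zero] at this
    exact sub_eq_iff_eq_add.1 this
  -- `T Yp` has the trace of `Yp`, and its compression by `P` already has at least that trace
  have h1 : (1 - P) * T Yp = 0 := by
    apply trace_mul_eq_zero_of_projection hQ hQQ (hT _ hp)
    rw [sub_mul, one_mul, trace_sub, htr, hPT, trace_add, sub_add_cancel_left]
    exact neg_nonpos.2 (hpos _ (hT _ hm) P hP hPP)
  have h1' : T Yp = P * T Yp := by rwa [sub_mul, one_mul, sub_eq_zero] at h1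
  have h2 : P * T Ym = 0 := by
    apply trace_mul_eq_zero_of_projection hP hPP (hT _ hm)
    have := congrArg trace hPT
    rw [trace_add, ← h1', htr] at this
    exact (left_eq_add.1 this).le
  have h3 : T Yp = Yp := by rw [h1', hPT, h2, add_zero]
  have h4 : T Ym = Ym := by rw [h3] at hTd; exact sub_right_injective hTd
  refine ⟨Yp + Ym, hp.add hm, by rw [map_add, h3, h4], fun v hv => ?_⟩
  rw [hYe, sub_mulVec, hp.mulVec_eq_zero_of_add hm hv,
    hm.mulVec_eq_zero_of_add hp (by rwa [add_comm]), sub_zero]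

end Matrix

/-! ### Stationary states of GKLS generators -/

namespace Matrix

open scoped ComplexOrder

variable {n ι : Type*} [Fintype n] [Fintype ι]

/-- The map `X ↦ G X + X Gᴴ + ∑ j, A j X (A j)ᴴ`. It is the GKLS generator with noise operators
`A j` when `G + Gᴴ + ∑ j, (A j)ᴴ A j = 0`. -/
noncomputable def gkls (G : Matrix n n ℂ) (A : ι → Matrix n n ℂ) (X : Matrix n n ℂ) :
    Matrix n n ℂ :=
  G * X + X * Gᴴ + ∑ j, A j * X * (A j)ᴴ

variable {G : Matrix n n ℂ} {A : ι → Matrix n n ℂ}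

theorem gkls_zero : gkls G A 0 = 0 := by
  simp [gkls]

theorem gkls_add (X Y : Matrix n n ℂ) : gkls G A (X + Y) = gkls G A X + gkls G A Y := by
  simp only [gkls, mul_add, add_mul, Finset.sum_add_distrib]
  abel

theorem gkls_conjTranspose (X : Matrix n n ℂ) : gkls G A Xᴴ = (gkls G A X)ᴴ := by
  simp only [gkls, conjTranspose_add, conjTranspose_mul, conjTranspose_sum,
    conjTranspose_conjTranspose, Matrix.mul_assoc]
  abel

/-- The trace dual of a generator has the same form, with adjoint coefficients. -/
theorem trace_gkls_mul (X Y : Matrix n n ℂ) :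
    (gkls G A X * Y).trace = (X * gkls Gᴴ (fun j => (A j)ᴴ) Y).trace := by
  simp only [gkls, add_mul, mul_add, Finset.sum_mul, Finset.mul_sum, trace_add, trace_sum,
    conjTranspose_conjTranspose]
  have h1 : (G * X * Y).trace = (X * (Y * G)).trace := by
    rw [Matrix.mul_assoc, trace_mul_comm, Matrix.mul_assoc]
  have h2 : ∀ j, (A j * X * (A j)ᴴ * Y).trace = (X * ((A j)ᴴ * Y * A j)).trace := fun j => by
    rw [Matrix.mul_assoc, Matrix.mul_assoc, trace_mul_comm]
    simp only [Matrix.mul_assoc]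
  rw [h1, Finset.sum_congr rfl fun j _ => h2 j, Matrix.mul_assoc X Gᴴ Y]
  ring

theorem gkls_dual_one [DecidableEq n] (hG : G + Gᴴ + ∑ j, (A j)ᴴ * A j = 0) :
    gkls Gᴴ (fun j => (A j)ᴴ) 1 = 0 := by
  simpa [gkls, add_comm] using hG

theorem trace_gkls (hG : G + Gᴴ + ∑ j, (A j)ᴴ * A j = 0) (X : Matrix n n ℂ) :
    (gkls G A X).trace = 0 := by
  classical
  rw [← Matrix.mul_one (gkls G A X), trace_gkls_mul, gkls_dual_one hG, Matrix.mul_zero, trace_zero]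

/-- Every Hermitian stationary matrix is dominated by a positive semidefinite stationary matrix. With
`V = 1 - G`, `M X = X + ∑ j, A j X (A j)ᴴ + G X Gᴴ` and `C Z = V⁻¹ Z (V⁻¹)ᴴ`, the equation
`gkls G A X = 0` says that `V X Vᴴ` is a fixed point of `M ∘ C`, which is positive and
trace-preserving. -/
theorem exists_posSemidef_stationary_of_hermitian [DecidableEq n]
    (hG : G + Gᴴ + ∑ j, (A j)ᴴ * A j = 0) {Y : Matrix n n ℂ} (hY : Y.IsHermitian)
    (hLY : gkls G A Y = 0) :
    ∃ ρ : Matrix n n ℂ, ρ.PosSemidef ∧ gkls G A ρ = 0 ∧ ∀ v, ρ *ᵥ v = 0 → Y *ᵥ v = 0 := by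
  set V : Matrix n n ℂ := 1 - G with hV
  -- `V` is invertible, since `V Vᴴ = 1 + ∑ j, (A j)ᴴ A j + G Gᴴ`
  have hVV : (V * Vᴴ).PosDef := by
    have : V * Vᴴ = 1 + (∑ j, (A j)ᴴ * A j + G * Gᴴ) := by
      have h : ∑ j, (A j)ᴴ * A j = - G - Gᴴ := by
        rw [← sub_eq_zero, ← hG]; abel
      rw [h, hV, conjTranspose_sub, conjTranspose_one]
      noncomm_ring
    rw [this]
    exact PosDef.one.add_posSemidef ((posSemidef_sum _ fun j _ =>
      posSemidef_conjTranspose_mul_self _).add (posSemidef_self_mul_conjTranspose _))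
  have hVu : IsUnit V := by
    have h := (isUnit_iff_isUnit_det _).1 hVV.isUnit
    rw [det_mul] at h
    exact (isUnit_iff_isUnit_det _).2 (isUnit_of_mul_isUnit_left h)
  have hdet := (isUnit_iff_isUnit_det _).1 hVu
  set W := V⁻¹ with hW
  have hVW : V * W = 1 := mul_nonsing_inv _ hdet
  have hWV : W * V = 1 := nonsing_inv_mul _ hdet
  have hVWs : Wᴴ * Vᴴ = 1 := by rw [← conjTranspose_mul, hVW, conjTranspose_one]
  have hWVs : Vᴴ * Wᴴ = 1 := by rw [← conjTranspose_mul, hWV, conjTranspose_one]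
  let M : Matrix n n ℂ →ₗ[ℂ] Matrix n n ℂ :=
    { toFun := fun X => X + ∑ j, A j * X * (A j)ᴴ + G * X * Gᴴ
      map_add' := fun X Y => by
        simp only [mul_add, add_mul, Finset.sum_add_distrib]; abel
      map_smul' := fun c X => by
        simp only [Matrix.mul_smul, Matrix.smul_mul, ← Finset.smul_sum, smul_add,
          RingHom.id_apply] }
  have hM : ∀ X, M X = V * X * Vᴴ + gkls G A X := fun X => by
    change X + ∑ j, A j * X * (A j)ᴴ + G * X * Gᴴ = _
    rw [gkls, hV, conjTranspose_sub, conjTranspose_one]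
    noncomm_ring
  have hMpos : ∀ X : Matrix n n ℂ, X.PosSemidef → (M X).PosSemidef := fun X hX =>
    (hX.add (posSemidef_sum _ fun j _ => hX.mul_mul_conjTranspose_same _)).add
      (hX.mul_mul_conjTranspose_same _)
  let C : Matrix n n ℂ →ₗ[ℂ] Matrix n n ℂ := LinearMap.mulLeft ℂ W ∘ₗ LinearMap.mulRight ℂ Wᴴ
  have hC : ∀ Z, C Z = W * Z * Wᴴ := fun Z => (Matrix.mul_assoc _ _ _).symm
  have hVC : ∀ Z, V * C Z * Vᴴ = Z := fun Z => by
    rw [hC]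
    calc V * (W * Z * Wᴴ) * Vᴴ = (V * W) * Z * (Wᴴ * Vᴴ) := by simp only [Matrix.mul_assoc]
      _ = Z := by rw [hVW, hVWs, Matrix.one_mul, Matrix.mul_one]
  have hCV : ∀ Z, C (V * Z * Vᴴ) = Z := fun Z => by
    rw [hC]
    calc W * (V * Z * Vᴴ) * Wᴴ = (W * V) * Z * (Vᴴ * Wᴴ) := by simp only [Matrix.mul_assoc]
      _ = Z := by rw [hWV, hWVs, Matrix.one_mul, Matrix.mul_one]
  obtain ⟨σ, hσ, hTσ, hker⟩ := exists_posSemidef_fixed_of_hermitian_fixed (M ∘ₗ C)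
    (fun X hX => hMpos _ (by rw [hC]; exact hX.mul_mul_conjTranspose_same W))
    (fun X => by rw [LinearMap.comp_apply, hM, hVC, trace_add, trace_gkls hG, add_zero])
    (isHermitian_mul_mul_conjTranspose V hY)
    (by rw [LinearMap.comp_apply, hCV, hM, hLY, add_zero])
  refine ⟨C σ, by rw [hC]; exact hσ.mul_mul_conjTranspose_same W, ?_, fun v hv => ?_⟩
  · rw [LinearMap.comp_apply, hM, hVC] at hTσ
    exact left_eq_add.1 hTσ.symm
  · have h1 : σ *ᵥ (Wᴴ *ᵥ v) = 0 := by
      have := congrArg (V *ᵥ ·) hv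
      simp only [hC, mulVec_mulVec, mulVec_zero] at this
      rw [mulVec_mulVec, ← this]
      congr 1
      calc σ * Wᴴ = V * W * (σ * Wᴴ) := by rw [hVW, Matrix.one_mul]
        _ = _ := by simp only [Matrix.mul_assoc]
    have h2 := congrArg (W *ᵥ ·) (hker _ h1)
    simp only [mulVec_mulVec, mulVec_zero] at h2
    rw [← h2]
    congr 1
    calc Y = (W * V) * Y * (Vᴴ * Wᴴ) := by rw [hWV, hWVs, Matrix.one_mul, Matrix.mul_one]
      _ = _ := by simp only [Matrix.mul_assoc]

theorem sum_fromBlocks {l m : Type*} (a : ι → Matrix l l ℂ) (b : ι → Matrix l m ℂ)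
    (c : ι → Matrix m l ℂ) (d : ι → Matrix m m ℂ) :
    ∑ j, fromBlocks (a j) (b j) (c j) (d j) =
      fromBlocks (∑ j, a j) (∑ j, b j) (∑ j, c j) (∑ j, d j) := by
  ext (i | i) (k | k) <;> simp [Matrix.sum_apply]

theorem gkls_fromBlocks (G₁ G₂ : Matrix n n ℂ) (a b c d : Matrix n n ℂ) :
    gkls (fromBlocks G₁ 0 0 G₂) (fun j => fromBlocks (A j) 0 0 (A j)) (fromBlocks a b c d) =
      fromBlocks (G₁ * a + a * G₁ᴴ + ∑ j, A j * a * (A j)ᴴ)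
        (G₁ * b + b * G₂ᴴ + ∑ j, A j * b * (A j)ᴴ)
        (G₂ * c + c * G₁ᴴ + ∑ j, A j * c * (A j)ᴴ)
        (G₂ * d + d * G₂ᴴ + ∑ j, A j * d * (A j)ᴴ) := by
  simp [gkls, fromBlocks_multiply, fromBlocks_conjTranspose, sum_fromBlocks, fromBlocks_add]

/-- A kernel vector `v` of a principal block of `ρ ≥ 0` extends by zero to a kernel vector `u` of `ρ`.
The extension enters only through the value of the quadratic form. -/
theorem PosSemidef.mulVec_eq_zero_of_submatrix {m : Type*} [Fintype m] {ρ : Matrix n n ℂ}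
    (hρ : ρ.PosSemidef) {u : n → ℂ} {v : m → ℂ} {e : m → n}
    (hu : star u ⬝ᵥ (ρ *ᵥ u) = star v ⬝ᵥ (ρ.submatrix e e *ᵥ v))
    (hv : ρ.submatrix e e *ᵥ v = 0) : ρ *ᵥ u = 0 := by
  classical
  rw [← hρ.dotProduct_mulVec_zero_iff, hu, hv, dotProduct_zero]

/-- Every peripheral eigenvector is dominated by a stationary state. The phase is removed by passing
to the generator on `n ⊕ n` whose Hamiltonian is shifted by `ω` on the first summand: there the
Hermitian matrix with off-diagonal blocks `X`, `Xᴴ` is stationary. -/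
theorem exists_posSemidef_stationary_of_eigenvector [DecidableEq n]
    (hG : G + Gᴴ + ∑ j, (A j)ᴴ * A j = 0) {X : Matrix n n ℂ} {ω : ℝ}
    (hX : gkls G A X = (ω * Complex.I) • X) :
    ∃ ρ : Matrix n n ℂ, ρ.PosSemidef ∧ gkls G A ρ = 0 ∧
      ∀ v, ρ *ᵥ v = 0 → X *ᵥ v = 0 ∧ Xᴴ *ᵥ v = 0 := by
  set c : ℂ := ω * Complex.I with hc
  have hcs : star c = -c := by simp [hc]
  set G₁ : Matrix n n ℂ := G - c • 1 with hG₁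
  have hG₁s : G₁ᴴ = Gᴴ + c • 1 := by
    rw [hG₁, conjTranspose_sub, conjTranspose_smul, hcs, conjTranspose_one]; simp
  have hXs : gkls G A Xᴴ = -(c • Xᴴ) := by
    rw [gkls_conjTranspose, hX, conjTranspose_smul, hcs, neg_smul]
  obtain ⟨ρ, hρ, hLρ, hker⟩ := exists_posSemidef_stationary_of_hermitian
    (G := fromBlocks G₁ 0 0 G) (A := fun j => fromBlocks (A j) 0 0 (A j))
    (Y := fromBlocks 0 X Xᴴ 0)
    (by
      simp only [fromBlocks_conjTranspose, fromBlocks_multiply, sum_fromBlocks, fromBlocks_add,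
        hG₁s, conjTranspose_zero, mul_zero, zero_mul, add_zero, zero_add, Finset.sum_const_zero]
      rw [hG]
      have : G₁ + (Gᴴ + c • 1) + ∑ j, (A j)ᴴ * A j = 0 := by
        rw [← hG, hG₁]; abel
      rw [this, fromBlocks_zero])
    (by rw [IsHermitian, fromBlocks_conjTranspose]; simp)
    (by
      rw [gkls_fromBlocks, hG₁s]
      have h1 : G₁ * X + X * Gᴴ + ∑ j, A j * X * (A j)ᴴ = 0 := by
        have : G₁ * X + X * Gᴴ + ∑ j, A j * X * (A j)ᴴ = gkls G A X - c • X := by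
          rw [gkls, hG₁, sub_mul, Matrix.smul_mul, Matrix.one_mul]; abel
        rw [this, hX, sub_self]
      have h2 : G * Xᴴ + Xᴴ * (Gᴴ + c • 1) + ∑ j, A j * Xᴴ * (A j)ᴴ = 0 := by
        have : G * Xᴴ + Xᴴ * (Gᴴ + c • 1) + ∑ j, A j * Xᴴ * (A j)ᴴ
            = gkls G A Xᴴ + c • Xᴴ := by
          rw [gkls, mul_add, Matrix.mul_smul, Matrix.mul_one]; abel
        rw [this, hXs, neg_add_cancel]
      rw [h1, h2]
      simp)
  have hρb := (fromBlocks_toBlocks ρ).symm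
  rw [hρb, gkls_fromBlocks, hG₁s, ← fromBlocks_zero, fromBlocks_inj] at hLρ
  have h1 : ρ.toBlocks₁₁.PosSemidef := hρ.submatrix Sum.inl
  have h2 : ρ.toBlocks₂₂.PosSemidef := hρ.submatrix Sum.inr
  refine ⟨ρ.toBlocks₁₁ + ρ.toBlocks₂₂, h1.add h2, ?_, fun v hv => ⟨?_, ?_⟩⟩
  · rw [gkls_add]
    have e1 : gkls G A ρ.toBlocks₁₁ = 0 := by
      rw [← hLρ.1, gkls, hG₁, sub_mul, mul_add]
      simp only [Matrix.smul_mul, Matrix.mul_smul, Matrix.one_mul, Matrix.mul_one]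
      abel
    have e2 : gkls G A ρ.toBlocks₂₂ = 0 := hLρ.2.2.2
    rw [e1, e2, add_zero]
  · have hv2 := h2.mulVec_eq_zero_of_add h1 (by rwa [add_comm])
    have := hker (Sum.elim 0 v) (hρ.mulVec_eq_zero_of_submatrix (e := Sum.inr) (v := v) (by
      rw [hρb, fromBlocks_mulVec, ← hρb]
      simp [dotProduct, Fintype.sum_sum_type, toBlocks₂₂, submatrix, mulVec]) hv2)
    simpa [fromBlocks_mulVec] using congrArg (· ∘ Sum.inl) this
  · have hv1 := h1.mulVec_eq_zero_of_add h2 hv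
    have := hker (Sum.elim v 0) (hρ.mulVec_eq_zero_of_submatrix (e := Sum.inl) (v := v) (by
      rw [hρb, fromBlocks_mulVec, ← hρb]
      simp [dotProduct, Fintype.sum_sum_type, toBlocks₁₁, submatrix, mulVec]) hv1)
    simpa [fromBlocks_mulVec] using congrArg (· ∘ Sum.inr) this

/-- A stationary state whose support contains the supports of all peripheral eigenvectors, obtained
as a stationary state with kernel of minimal dimension. -/
theorem exists_maximal_stationary [DecidableEq n] (hG : G + Gᴴ + ∑ j, (A j)ᴴ * A j = 0) :
    ∃ ρ : Matrix n n ℂ, ρ.PosSemidef ∧ gkls G A ρ = 0 ∧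
      ∀ (ω : ℝ) (X : Matrix n n ℂ), gkls G A X = (ω * Complex.I) • X →
        ∀ v, ρ *ᵥ v = 0 → X *ᵥ v = 0 ∧ Xᴴ *ᵥ v = 0 := by
  let S : Set ℕ := {k | ∃ ρ : Matrix n n ℂ, ρ.PosSemidef ∧ gkls G A ρ = 0 ∧
    Module.finrank ℂ (LinearMap.ker ρ.mulVecLin) = k}
  have hS : S.Nonempty := ⟨_, 0, PosSemidef.zero, gkls_zero, rfl⟩
  obtain ⟨ρ, hρ, hLρ, hk⟩ := Nat.sInf_mem hS
  refine ⟨ρ, hρ, hLρ, fun ω X hX v hv => ?_⟩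
  obtain ⟨σ, hσ, hLσ, hker⟩ := exists_posSemidef_stationary_of_eigenvector hG hX
  have hle : LinearMap.ker (ρ + σ).mulVecLin ≤ LinearMap.ker ρ.mulVecLin := fun u hu =>
    hρ.mulVec_eq_zero_of_add hσ hu
  have hmin : Module.finrank ℂ (LinearMap.ker ρ.mulVecLin) ≤
      Module.finrank ℂ (LinearMap.ker (ρ + σ).mulVecLin) := by
    rw [hk]
    exact Nat.sInf_le ⟨ρ + σ, hρ.add hσ, by rw [gkls_add, hLρ, hLσ, add_zero], rfl⟩
  have heq := Submodule.eq_of_le_of_finrank_le hle hmin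
  have hv' : v ∈ LinearMap.ker (ρ + σ).mulVecLin := by
    rw [heq]; exact hv
  exact hker v (hσ.mulVec_eq_zero_of_add hρ (by rw [add_comm]; exact hv'))

end Matrix

/-! ### The action of a GKLS generator on its peripheral eigenvectors -/

namespace Matrix

open scoped ComplexOrder

variable {n ι : Type*} [Fintype n] [Fintype ι] {G : Matrix n n ℂ} {A : ι → Matrix n n ℂ}

/-- The dissipation identity. On the right-hand side the terms containing `G` cancel. Applied to a
generator, and with `ρ = 1` to its dual, it shows that peripheral eigenvectors commute with the
noise operators. -/
theorem sum_commutator_mul_conjTranspose (x ρ : Matrix n n ℂ) :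
    ∑ j, (A j * x - x * A j) * ρ * (A j * x - x * A j)ᴴ =
      gkls G A (x * ρ * xᴴ) - gkls G A (x * ρ) * xᴴ - x * gkls G A (ρ * xᴴ) +
        x * gkls G A ρ * xᴴ := by
  have h : ∀ j, (A j * x - x * A j) * ρ * (A j * x - x * A j)ᴴ =
      A j * (x * ρ * xᴴ) * (A j)ᴴ - (A j * (x * ρ) * (A j)ᴴ) * xᴴ
        - x * (A j * (ρ * xᴴ) * (A j)ᴴ) + x * (A j * ρ * (A j)ᴴ) * xᴴ := fun j => by
    rw [conjTranspose_sub, conjTranspose_mul, conjTranspose_mul]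
    noncomm_ring
  simp only [h, gkls, Finset.sum_add_distrib, Finset.sum_sub_distrib, ← Finset.sum_mul,
    ← Finset.mul_sum]
  noncomm_ring

theorem gkls_mul_of_commute {x : Matrix n n ℂ} (hx : ∀ j, A j * x = x * A j)
    (ρ : Matrix n n ℂ) :
    gkls G A (x * ρ) = (G * x - x * G) * ρ + x * gkls G A ρ := by
  have h : ∀ j, A j * (x * ρ) * (A j)ᴴ = x * (A j * ρ * (A j)ᴴ) := fun j => by
    rw [← Matrix.mul_assoc, hx]; simp only [Matrix.mul_assoc]
  simp only [gkls, h, ← Finset.mul_sum]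
  noncomm_ring

/-- A peripheral eigenvector `x ρ`, where `ρ` is a faithful stationary state, has `x` in the
commutant of the noise operators and their adjoints. The dissipation identity for the generator
gives `[A j, x] = 0`; this makes `xᴴ` a peripheral eigenvector of the dual generator, whose
dissipation identity gives `[(A j)ᴴ, x] = 0`. -/
theorem commute_of_eigenvector [DecidableEq n] (hG : G + Gᴴ + ∑ j, (A j)ᴴ * A j = 0)
    {ρ : Matrix n n ℂ} (hρ : ρ.PosDef) (hLρ : gkls G A ρ = 0) {x : Matrix n n ℂ} {ω : ℝ}
    (hx : gkls G A (x * ρ) = (ω * Complex.I) • (x * ρ)) :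
    (∀ j, A j * x = x * A j) ∧ (∀ j, (A j)ᴴ * x = x * (A j)ᴴ) ∧
      G * x - x * G = (ω * Complex.I) • x := by
  set c : ℂ := ω * Complex.I with hc
  have hcs : star c = -c := by simp [hc]
  have hxs : gkls G A (ρ * xᴴ) = -(c • (ρ * xᴴ)) := by
    have : ρ * xᴴ = (x * ρ)ᴴ := by rw [conjTranspose_mul, hρ.1.eq]
    rw [this, gkls_conjTranspose, hx, conjTranspose_smul, hcs, neg_smul]
  have h1 : ∀ j, A j * x = x * A j := by
    refine fun j => sub_eq_zero.1 (hρ.eq_zero_of_sum_trace_eq_zero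
      (D := fun j => A j * x - x * A j) ?_ j)
    rw [sum_commutator_mul_conjTranspose (G := G), hx, hxs, hLρ, trace_add, trace_sub, trace_sub,
      trace_gkls hG]
    simp [Matrix.mul_assoc]
  have h2 : G * x - x * G = c • x := by
    rw [gkls_mul_of_commute h1, hLρ, Matrix.mul_zero, add_zero, ← Matrix.smul_mul] at hx
    exact hρ.isUnit.mul_left_injective hx
  have h3 : ∀ j, (A j)ᴴ * xᴴ = xᴴ * (A j)ᴴ := fun j => by
    rw [← conjTranspose_mul, ← conjTranspose_mul, h1]
  have h4 : gkls Gᴴ (fun j => (A j)ᴴ) xᴴ = c • xᴴ := by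
    have := gkls_mul_of_commute (G := Gᴴ) (A := fun j => (A j)ᴴ) h3 1
    rw [gkls_dual_one hG, Matrix.mul_one, Matrix.mul_zero, add_zero, Matrix.mul_one] at this
    rw [this]
    have h2s := congrArg conjTranspose h2
    rw [conjTranspose_sub, conjTranspose_mul, conjTranspose_mul, conjTranspose_smul, hcs] at h2s
    rw [← neg_sub, h2s, neg_smul, neg_neg]
  have h5 : gkls Gᴴ (fun j => (A j)ᴴ) x = -(c • x) := by
    rw [← conjTranspose_conjTranspose x, gkls_conjTranspose, h4, conjTranspose_smul, hcs, neg_smul]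
  refine ⟨h1, fun j => ?_, h2⟩
  have hid := sum_commutator_mul_conjTranspose (G := Gᴴ) (A := fun j => (A j)ᴴ) x 1
  simp only [Matrix.mul_one, Matrix.one_mul, gkls_dual_one hG, h4, h5, Matrix.mul_zero,
    Matrix.zero_mul, add_zero, Matrix.neg_mul, Matrix.mul_smul, Matrix.smul_mul,
    sub_neg_eq_add, add_sub_cancel_right] at hid
  have h6 := hρ.eq_zero_of_sum_trace_eq_zero (D := fun j => ((A j)ᴴ * x - x * (A j)ᴴ)ᴴ) (by
    have : (∑ j, ((A j)ᴴ * x - x * (A j)ᴴ)ᴴ * ρ * ((A j)ᴴ * x - x * (A j)ᴴ)ᴴᴴ).trace =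
        (ρ * ∑ j, ((A j)ᴴ * x - x * (A j)ᴴ) * ((A j)ᴴ * x - x * (A j)ᴴ)ᴴ).trace := by
      rw [Finset.mul_sum, trace_sum, trace_sum]
      refine Finset.sum_congr rfl fun j _ => ?_
      rw [conjTranspose_conjTranspose, Matrix.mul_assoc, trace_mul_comm, Matrix.mul_assoc]
    rw [this, hid, ← trace_gkls_mul, hLρ, Matrix.zero_mul, trace_zero]) j
  exact sub_eq_zero.1 (conjTranspose_eq_zero.1 h6)

/-- The smallest set containing the `A j` and `(A j)ᴴ` that is stable under the commutator with `K`,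
on either side. -/
inductive IteratedCommutator (K : Matrix n n ℂ) (A : ι → Matrix n n ℂ) : Matrix n n ℂ → Prop
  | of (j : ι) : IteratedCommutator K A (A j)
  | conj (j : ι) : IteratedCommutator K A (A j)ᴴ
  | left {s : Matrix n n ℂ} : IteratedCommutator K A s → IteratedCommutator K A (K * s - s * K)
  | right {s : Matrix n n ℂ} : IteratedCommutator K A s → IteratedCommutator K A (s * K - K * s)

theorem IteratedCommutator.conjTranspose {ι : Type*} {A : ι → Matrix n n ℂ}
    {K : Matrix n n ℂ} (hK : K.IsHermitian) {s : Matrix n n ℂ}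
    (hs : IteratedCommutator K A s) : IteratedCommutator K A sᴴ := by
  induction hs with
  | of j => exact .conj j
  | conj j => rw [conjTranspose_conjTranspose]; exact .of j
  | left _ ih =>
    rw [conjTranspose_sub, conjTranspose_mul, conjTranspose_mul, hK.eq]; exact .right ih
  | right _ ih =>
    rw [conjTranspose_sub, conjTranspose_mul, conjTranspose_mul, hK.eq]; exact .left ih

/-- The decoherence-free algebra: the commutant of all iterated commutators of the noise operators
with the Hamiltonian. -/
def decoherenceFree (K : Matrix n n ℂ) (A : ι → Matrix n n ℂ) [DecidableEq n] :
    Subalgebra ℂ (Matrix n n ℂ) :=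
  Subalgebra.centralizer ℂ {s | IteratedCommutator K A s}

section decoherenceFree

variable {ι : Type*} {A : ι → Matrix n n ℂ} [DecidableEq n] {K x : Matrix n n ℂ}

theorem mem_decoherenceFree :
    x ∈ decoherenceFree K A ↔ ∀ s, IteratedCommutator K A s → s * x = x * s :=
  Subalgebra.mem_centralizer_iff ℂ

theorem conjTranspose_mem_decoherenceFree (hK : K.IsHermitian) (hx : x ∈ decoherenceFree K A) :
    xᴴ ∈ decoherenceFree K A := by
  rw [mem_decoherenceFree] at hx ⊢
  intro s hs
  have := congrArg conjTranspose (hx _ (hs.conjTranspose hK))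
  simpa only [conjTranspose_mul, conjTranspose_conjTranspose] using this.symm

theorem commutator_mem_decoherenceFree (hx : x ∈ decoherenceFree K A) :
    K * x - x * K ∈ decoherenceFree K A := by
  rw [mem_decoherenceFree] at hx ⊢
  intro s hs
  have h1 := hx s hs
  have h2 := hx _ hs.left
  rw [← sub_eq_zero] at h1 h2 ⊢
  calc s * (K * x - x * K) - (K * x - x * K) * s
      = K * (s * x - x * s) - (s * x - x * s) * K -
        ((K * s - s * K) * x - x * (K * s - s * K)) := by noncomm_ring
    _ = 0 := by rw [h1, h2]; simp

theorem mem_decoherenceFree_of_eigenvector {c : ℂ} (h1 : ∀ j, A j * x = x * A j)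
    (h2 : ∀ j, (A j)ᴴ * x = x * (A j)ᴴ) (h3 : K * x - x * K = c • x) :
    x ∈ decoherenceFree K A := by
  have key : ∀ s, s * x = x * s → (K * s - s * K) * x = x * (K * s - s * K) := by
    intro s ih
    rw [← sub_eq_zero] at ih ⊢
    calc (K * s - s * K) * x - x * (K * s - s * K)
        = K * (s * x - x * s) - (s * x - x * s) * K
          + ((K * x - x * K) * s - s * (K * x - x * K)) := by noncomm_ring
      _ = K * (s * x - x * s) - (s * x - x * s) * K - c • (s * x - x * s) := by
        rw [h3, Matrix.smul_mul, Matrix.mul_smul, smul_sub]; abel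
      _ = 0 := by rw [ih]; simp
  rw [mem_decoherenceFree]
  intro s hs
  induction hs with
  | of j => exact h1 j
  | conj j => exact h2 j
  | left _ ih => exact key _ ih
  | @right s _ ih =>
    rw [← neg_sub (K * s) (s * K), neg_mul, mul_neg, key _ ih]

end decoherenceFree

/-- A derivation `[K, ·]` with `K` Hermitian that preserves a `*`-subalgebra `N` is implemented by a
Hermitian element of `N`, namely the Hilbert–Schmidt orthogonal projection of `K` onto `N`. -/
theorem exists_hermitian_mem_commutator_eq [DecidableEq n] (N : Subalgebra ℂ (Matrix n n ℂ))
    (hN : ∀ x ∈ N, xᴴ ∈ N) {K : Matrix n n ℂ} (hK : K.IsHermitian)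
    (hKN : ∀ x ∈ N, K * x - x * K ∈ N) :
    ∃ h ∈ N, h.IsHermitian ∧ ∀ x ∈ N, h * x - x * h = K * x - x * K := by
  obtain ⟨h, hh, horth⟩ : ∃ h ∈ N, ∀ y ∈ N, ((K - h) * yᴴ).trace = 0 := by
    let := Matrix.toMatrixNormedAddCommGroup (1 : Matrix n n ℂ) PosDef.one
    let := Matrix.toMatrixInnerProductSpace (1 : Matrix n n ℂ) PosDef.one.posSemidef
    let S : Submodule ℂ (Matrix n n ℂ) := Subalgebra.toSubmodule N
    refine ⟨S.starProjection K, S.starProjection_apply_mem K, fun y hy => ?_⟩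
    have h : ((K - S.starProjection K) * 1 * yᴴ).trace = 0 :=
      (S.mem_orthogonal _).1 (S.sub_starProjection_mem_orthogonal K) y hy
    rwa [Matrix.mul_one] at h
  have h0 : ∀ x ∈ N, h * x - x * h = K * x - x * K := by
    intro x hx
    set z := (K - h) * x - x * (K - h) with hz
    have hzN : z ∈ N := by
      have : z = (K * x - x * K) - (h * x - x * h) := by rw [hz]; noncomm_ring
      rw [this]
      exact N.sub_mem (hKN x hx) (N.sub_mem (N.mul_mem hh hx) (N.mul_mem hx hh))
    have h1 : (z * zᴴ).trace = 0 := by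
      have e : (z * zᴴ).trace = ((K - h) * (zᴴᴴ * xᴴ - xᴴ * zᴴᴴ)ᴴ).trace := by
        simp only [conjTranspose_sub, conjTranspose_mul, conjTranspose_conjTranspose]
        nth_rw 1 [hz]
        rw [sub_mul _ _ zᴴ, mul_sub (K - h) (x * zᴴ), trace_sub, trace_sub, Matrix.mul_assoc,
          Matrix.mul_assoc x, trace_mul_comm x, Matrix.mul_assoc]
      rw [e]
      refine horth _ (N.sub_mem (N.mul_mem ?_ (hN _ hx)) (N.mul_mem (hN _ hx) ?_)) <;>
        rwa [conjTranspose_conjTranspose]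
    rw [trace_mul_conjTranspose_self_eq_zero_iff] at h1
    have : z = (K * x - x * K) - (h * x - x * h) := by rw [hz]; noncomm_ring
    rw [h1] at this
    exact (sub_eq_zero.1 this.symm).symm
  have h0s : ∀ x ∈ N, hᴴ * x - x * hᴴ = K * x - x * K := by
    intro x hx
    have := congrArg conjTranspose (h0 _ (hN x hx))
    simp only [conjTranspose_sub, conjTranspose_mul, conjTranspose_conjTranspose, hK.eq] at this
    rw [← neg_sub (x * hᴴ), this, neg_sub]
  refine ⟨(1 / 2 : ℂ) • (h + hᴴ), N.smul_mem (N.add_mem hh (hN _ hh)) _, ?_, fun x hx => ?_⟩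
  · rw [IsHermitian, conjTranspose_smul, conjTranspose_add, conjTranspose_conjTranspose, add_comm]
    simp
  · have : ((1 / 2 : ℂ) • (h + hᴴ)) * x - x * ((1 / 2 : ℂ) • (h + hᴴ)) =
        (1 / 2 : ℂ) • ((h * x - x * h) + (hᴴ * x - x * hᴴ)) := by
      rw [Matrix.smul_mul, Matrix.mul_smul, ← smul_sub]
      congr 1
      noncomm_ring
    rw [this, h0 x hx, h0s x hx, ← two_smul ℂ, smul_smul]
    norm_num

/-- In the presence of a faithful stationary state `ρ`, a generator acts on its peripheral
eigenvectors as a commutator with a Hermitian matrix. These eigenvectors have the form `x ρ` with `x`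
in the decoherence-free algebra, so it suffices to implement the derivation `[K, ·]` of that algebra
by a Hermitian element `h` of it, and to check that `h` commutes with `ρ`. -/
theorem exists_hermitian_of_faithful_stationary [DecidableEq n]
    (hG : G + Gᴴ + ∑ j, (A j)ᴴ * A j = 0) {ρ : Matrix n n ℂ} (hρ : ρ.PosDef)
    (hLρ : gkls G A ρ = 0) :
    ∃ h : Matrix n n ℂ, h.IsHermitian ∧ ∀ (ω : ℝ) (X : Matrix n n ℂ),
      gkls G A X = (ω * Complex.I) • X → h * X - X * h = -(ω : ℂ) • X := by
  set K : Matrix n n ℂ := (Complex.I / 2) • (G - Gᴴ) with hKdef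
  have hK : K.IsHermitian := by
    rw [IsHermitian, hKdef, conjTranspose_smul, conjTranspose_sub, conjTranspose_conjTranspose,
      ← neg_sub G, smul_neg, ← neg_smul]
    congr 1
    simp [neg_div]
  set B : Matrix n n ℂ := ∑ j, (A j)ᴴ * A j with hB
  have hKG : K = Complex.I • G + (Complex.I / 2) • B := by
    have : Gᴴ = -G - B := by rw [← sub_eq_zero, ← hG]; abel
    rw [hKdef, this]
    module
  have hKx : ∀ x : Matrix n n ℂ, (∀ j, A j * x = x * A j) → (∀ j, (A j)ᴴ * x = x * (A j)ᴴ) →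
      K * x - x * K = Complex.I • (G * x - x * G) := by
    intro x h1 h2
    have hBx : B * x = x * B := by
      rw [hB, Finset.sum_mul, Finset.mul_sum]
      refine Finset.sum_congr rfl fun j _ => ?_
      rw [Matrix.mul_assoc, h1, ← Matrix.mul_assoc, h2, Matrix.mul_assoc]
    rw [hKG, add_mul, mul_add, Matrix.smul_mul, Matrix.smul_mul, Matrix.mul_smul, Matrix.mul_smul,
      hBx, smul_sub]
    abel
  set N := decoherenceFree K A with hN
  have hNs : ∀ x ∈ N, xᴴ ∈ N := fun x hx => conjTranspose_mem_decoherenceFree hK hx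
  have hfac : ∀ X : Matrix n n ℂ, X = X * ρ⁻¹ * ρ := fun X => by
    rw [Matrix.mul_assoc, nonsing_inv_mul _ ((isUnit_iff_isUnit_det _).1 hρ.isUnit),
      Matrix.mul_one]
  have hmem : ∀ (ω : ℝ) (X : Matrix n n ℂ), gkls G A X = (ω * Complex.I) • X →
      ∃ x ∈ N, X = x * ρ ∧ K * x - x * K = -(ω : ℂ) • x := by
    intro ω X hX
    refine ⟨X * ρ⁻¹, ?_, hfac X, ?_⟩ <;> rw [hfac X] at hX
    · obtain ⟨h1, h2, h3⟩ := commute_of_eigenvector hG hρ hLρ hX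
      exact mem_decoherenceFree_of_eigenvector h1 h2 ((hKx _ h1 h2).trans (by rw [h3, smul_smul]))
    · obtain ⟨h1, h2, h3⟩ := commute_of_eigenvector hG hρ hLρ hX
      rw [hKx _ h1 h2, h3, smul_smul]
      congr 1
      linear_combination (ω : ℂ) * Complex.I_mul_I
  obtain ⟨h, hhN, hh, hcomm⟩ := exists_hermitian_mem_commutator_eq N hNs hK
    fun x hx => commutator_mem_decoherenceFree hx
  have hA : ∀ x ∈ N, (∀ j, A j * x = x * A j) ∧ (∀ j, (A j)ᴴ * x = x * (A j)ᴴ) := fun x hx =>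
    ⟨fun j => mem_decoherenceFree.1 hx _ (.of j), fun j => mem_decoherenceFree.1 hx _ (.conj j)⟩
  have hstat : gkls G A (h * ρ) = 0 := by
    have h1 := hKx h (hA h hhN).1 (hA h hhN).2
    rw [← hcomm h hhN, sub_self] at h1
    rw [gkls_mul_of_commute (hA h hhN).1, hLρ, Matrix.mul_zero, add_zero,
      (smul_eq_zero.1 h1.symm).resolve_left Complex.I_ne_zero, Matrix.zero_mul]
  have hstat' : gkls G A (ρ * h) = ((0 : ℝ) * Complex.I) • (ρ * h) := by
    have : ρ * h = (h * ρ)ᴴ := by rw [conjTranspose_mul, hh.eq, hρ.1.eq]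
    rw [this, gkls_conjTranspose, hstat]
    simp
  obtain ⟨y, hyN, hy, hKy⟩ := hmem 0 _ hstat'
  -- `h` commutes with `ρ`: `ρ h` is stationary, so `[ρ, h] = w ρ` with `w ∈ N` and `[h, w] = 0`,
  -- whence `tr (w ρ wᴴ) = tr ([ρ, h] wᴴ) = 0`.
  have hhρ : h * ρ = ρ * h := by
    set w := y - h with hw
    have hwN : w ∈ N := N.sub_mem hyN hhN
    have hwρ : w * ρ = ρ * h - h * ρ := by rw [hw, sub_mul, hy]
    have hhw : h * w - w * h = 0 := by
      have : h * w - w * h = h * y - y * h := by rw [hw]; noncomm_ring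
      rw [this, hcomm y hyN, hKy]
      simp
    have hhw' : h * wᴴ = wᴴ * h := by
      have := congrArg conjTranspose (sub_eq_zero.1 hhw)
      rw [conjTranspose_mul, conjTranspose_mul, hh.eq] at this
      exact this.symm
    have htr : (∑ _j : Unit, w * ρ * wᴴ).trace = 0 := by
      rw [Finset.sum_const, Finset.card_univ, Fintype.card_unit, one_smul, hwρ, sub_mul, trace_sub,
        Matrix.mul_assoc ρ, hhw', trace_mul_comm (h * ρ), ← Matrix.mul_assoc wᴴ, sub_eq_zero,
        trace_mul_comm]
    have hw0 : w = 0 := hρ.eq_zero_of_sum_trace_eq_zero (D := fun _ : Unit => w) htr ()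
    rw [hw0, Matrix.zero_mul] at hwρ
    exact (sub_eq_zero.1 hwρ.symm).symm
  refine ⟨h, hh, fun ω X hX => ?_⟩
  obtain ⟨x, hxN, rfl, hx⟩ := hmem ω X hX
  rw [Matrix.mul_assoc x, ← hhρ, ← Matrix.mul_assoc, ← Matrix.mul_assoc, ← sub_mul, hcomm x hxN, hx,
    Matrix.smul_mul]

/-- A GKLS generator acts on its peripheral eigenvectors as a commutator with a Hermitian matrix.
Compressing the generator to the support of a maximal stationary state `ρ`, and adding to `ρ` the
projection `Q` onto its kernel, reduces the claim to the faithful case on the same space. -/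
theorem exists_hermitian_of_gkls [DecidableEq n] (hG : G + Gᴴ + ∑ j, (A j)ᴴ * A j = 0) :
    ∃ h : Matrix n n ℂ, h.IsHermitian ∧ ∀ (ω : ℝ) (X : Matrix n n ℂ),
      gkls G A X = (ω * Complex.I) • X → h * X - X * h = -(ω : ℂ) • X := by
  obtain ⟨ρ, hρ, hLρ, hker⟩ := exists_maximal_stationary hG
  obtain ⟨Q, hQ, hQQ, hρQ, hpd⟩ := hρ.exists_kernel_projection
  have hQρ : Q * ρ = 0 := by
    have := congrArg conjTranspose hρQ
    rwa [conjTranspose_mul, hQ.eq, hρ.1.eq, conjTranspose_zero] at this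
  set P : Matrix n n ℂ := 1 - Q with hP
  have hPh : Pᴴ = P := isHermitian_one.sub hQ
  have hPQ : P * Q = 0 := by rw [hP, sub_mul, hQQ, one_mul, sub_self]
  have hQP : Q * P = 0 := by rw [hP, mul_sub, hQQ, mul_one, sub_self]
  have hPρ : P * ρ = ρ := by rw [hP, sub_mul, hQρ, one_mul, sub_zero]
  have hPadd : ∀ Z, Q * Z + P * Z = Z := fun Z => by rw [hP, sub_mul, one_mul]; abel
  -- `ρ + Q` is invertible, so vanishing against `ρ` means vanishing against `P`
  have hcancel : ∀ Z, Z * ρ = 0 → Z * P = 0 := fun Z hZ => by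
    have : (Z * P) * (ρ + Q) = 0 := by
      rw [mul_add, Matrix.mul_assoc, hPρ, hZ, Matrix.mul_assoc, hPQ, Matrix.mul_zero, add_zero]
    rwa [hpd.isUnit.mul_left_eq_zero] at this
  -- the support of a stationary state is invariant under the noise operators and under `G`
  have hQA : ∀ j, Q * A j * P = 0 := by
    have h1 : (∑ j, (Q * A j) * ρ * (Q * A j)ᴴ) = 0 := by
      have := congrArg (fun Z => Q * Z * Q) hLρ
      simp only [gkls, mul_add, add_mul, Finset.mul_sum, Finset.sum_mul, Matrix.mul_zero,
        Matrix.zero_mul] at this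
      have e1 : Q * (G * ρ) * Q = 0 := by
        rw [Matrix.mul_assoc, Matrix.mul_assoc, hρQ, Matrix.mul_zero, Matrix.mul_zero]
      have e2 : Q * (ρ * Gᴴ) * Q = 0 := by
        rw [← Matrix.mul_assoc, hQρ, Matrix.zero_mul, Matrix.zero_mul]
      rw [e1, e2, zero_add, zero_add] at this
      rw [← this]
      refine Finset.sum_congr rfl fun j _ => ?_
      rw [conjTranspose_mul, hQ.eq]
      simp only [Matrix.mul_assoc]
    intro j
    apply hcancel
    have hp : ∀ j, ((Q * A j) * ρ * (Q * A j)ᴴ).PosSemidef := fun j =>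
      hρ.mul_mul_conjTranspose_same _
    have h2 := congrArg trace h1
    rw [trace_sum, trace_zero,
      Finset.sum_eq_zero_iff_of_nonneg fun j _ => (hp j).trace_nonneg] at h2
    have h3 := (hp j).trace_eq_zero_iff.1 (h2 j (Finset.mem_univ j))
    have h4 : ρ * (Q * A j)ᴴ = 0 :=
      hρ.mul_eq_zero_of_conj_eq_zero (by rwa [conjTranspose_conjTranspose])
    have h5 := congrArg conjTranspose h4
    rwa [conjTranspose_mul, conjTranspose_conjTranspose, hρ.1.eq, conjTranspose_zero] at h5
  have hAP : ∀ j, A j * P = P * A j * P := fun j => by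
    rw [← hPadd (A j * P), ← Matrix.mul_assoc, hQA, zero_add, Matrix.mul_assoc]
  have hQG : Q * G * P = 0 := by
    apply hcancel
    have := congrArg (Q * ·) hLρ
    simp only [gkls, mul_add, Finset.mul_sum, Matrix.mul_zero] at this
    have e2 : Q * (ρ * Gᴴ) = 0 := by rw [← Matrix.mul_assoc, hQρ, Matrix.zero_mul]
    have e3 : ∀ j, Q * (A j * ρ * (A j)ᴴ) = 0 := fun j => by
      calc Q * (A j * ρ * (A j)ᴴ) = (Q * A j * P) * ρ * (A j)ᴴ := by
            nth_rw 1 [← hPρ]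
            simp only [Matrix.mul_assoc]
        _ = 0 := by rw [hQA, Matrix.zero_mul, Matrix.zero_mul]
    simp only [e2, e3, Finset.sum_const_zero, add_zero] at this
    rwa [Matrix.mul_assoc]
  have hGP : G * P = P * G * P := by
    rw [← hPadd (G * P), ← Matrix.mul_assoc, hQG, zero_add, Matrix.mul_assoc]
  have hPA : ∀ j, P * (A j)ᴴ = P * (A j)ᴴ * P := fun j => by
    have := congrArg conjTranspose (hAP j)
    simpa only [conjTranspose_mul, hPh, Matrix.mul_assoc] using this
  have hPG : P * Gᴴ = P * Gᴴ * P := by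
    have := congrArg conjTranspose hGP
    simpa only [conjTranspose_mul, hPh, Matrix.mul_assoc] using this
  -- the compressed generator agrees with the original one on the corner of `P`
  have hagree : ∀ Z, gkls (P * G * P) (fun j => P * A j * P) (P * Z * P) =
      gkls G A (P * Z * P) := fun Z => by
    have hPP : P * P = P := by
      nth_rw 1 [hP]; rw [sub_mul, hQP, one_mul, sub_zero]
    have e1 : G * (P * Z * P) = P * G * P * (P * Z * P) := by
      calc G * (P * Z * P) = G * P * (Z * P) := by simp only [Matrix.mul_assoc]
        _ = P * G * (P * P) * (Z * P) := by rw [hPP, hGP]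
        _ = _ := by simp only [Matrix.mul_assoc]
    have e2 : P * Z * P * Gᴴ = P * Z * P * (P * G * P)ᴴ := by
      rw [conjTranspose_mul, conjTranspose_mul, hPh]
      calc P * Z * P * Gᴴ = P * Z * (P * Gᴴ) := by simp only [Matrix.mul_assoc]
        _ = P * Z * ((P * P) * Gᴴ * P) := by rw [hPP, ← hPG]
        _ = _ := by simp only [Matrix.mul_assoc]
    have e3 : ∀ j, A j * (P * Z * P) * (A j)ᴴ = P * A j * P * (P * Z * P) * (P * A j * P)ᴴ :=
      fun j => by
      rw [conjTranspose_mul, conjTranspose_mul, hPh]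
      calc A j * (P * Z * P) * (A j)ᴴ = A j * P * Z * (P * (A j)ᴴ) := by
            simp only [Matrix.mul_assoc]
        _ = P * A j * (P * P) * Z * ((P * P) * (A j)ᴴ * P) := by rw [hPP, ← hPA, ← hAP]
        _ = _ := by simp only [Matrix.mul_assoc]
    simp only [gkls, e1, e2, e3]
  have hcorner : ∀ Z, Z * Q = 0 → Q * Z = 0 → P * Z * P = Z := fun Z h1 h2 => by
    rw [hP, sub_mul, mul_sub, one_mul, mul_one, h2, sub_zero, h1, sub_zero]
  have hG' : P * G * P + (P * G * P)ᴴ + ∑ j, (P * A j * P)ᴴ * (P * A j * P) = 0 := by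
    have e : ∀ j, (P * A j * P)ᴴ * (P * A j * P) = P * ((A j)ᴴ * A j) * P := fun j => by
      rw [← hAP, conjTranspose_mul, hPh]
      simp only [Matrix.mul_assoc]
    have := congrArg (fun Z => P * Z * P) hG
    simp only [mul_add, add_mul, Finset.mul_sum, Finset.sum_mul, Matrix.mul_zero,
      Matrix.zero_mul] at this
    simp only [e]
    rw [← this, conjTranspose_mul, conjTranspose_mul, hPh]
    simp only [Matrix.mul_assoc]
  have hstat : gkls (P * G * P) (fun j => P * A j * P) (ρ + Q) = 0 := by
    have e1 := hagree ρ
    rw [hcorner ρ hρQ hQρ, hLρ] at e1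
    have e2 : gkls (P * G * P) (fun j => P * A j * P) Q = 0 := by
      have a1 : ∀ Z, P * Z * P * Q = 0 := fun Z => by rw [Matrix.mul_assoc, hPQ, Matrix.mul_zero]
      have a2 : Q * (P * G * P)ᴴ = 0 := by
        rw [conjTranspose_mul, hPh, ← Matrix.mul_assoc, hQP, Matrix.zero_mul]
      simp only [gkls, a1, a2, Matrix.zero_mul, Finset.sum_const_zero, add_zero]
    rw [gkls_add, e1, e2, add_zero]
  obtain ⟨h, hh, hcomm⟩ := exists_hermitian_of_faithful_stationary hG' hpd hstat
  refine ⟨h, hh, fun ω X hX => hcomm ω X ?_⟩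
  have hXQ : X * Q = 0 := mul_eq_zero_of_mulVec (fun v hv => (hker ω X hX v hv).1) hρQ
  have hQX : Q * X = 0 := by
    have : Xᴴ * Q = 0 := mul_eq_zero_of_mulVec (fun v hv => (hker ω X hX v hv).2) hρQ
    have := congrArg conjTranspose this
    rwa [conjTranspose_mul, hQ.eq, conjTranspose_conjTranspose, conjTranspose_zero] at this
  rw [← hX, ← hcorner X hXQ hQX, hagree]

end Matrix

/-! ### Exponentials of operators and their eigenvectors -/

section Exponential

variable {V : Type*} [NormedAddCommGroup V] [NormedSpace ℂ V] [CompleteSpace V]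

namespace ContinuousLinearMap

theorem exp_apply_of_sq_eq_zero {N : V →L[ℂ] V} {v : V} (hv : N (N v) = 0) :
    NormedSpace.exp N v = v + N v := by
  have h1 : HasSum (fun k : ℕ => ((k.factorial : ℂ)⁻¹ • N ^ k) v) (NormedSpace.exp N v) :=
    (NormedSpace.exp_series_hasSum_exp' (𝕂 := ℂ) N).mapL (ContinuousLinearMap.apply ℂ V v)
  have h0 : ∀ k : ℕ, (N ^ (k + 2)) v = 0 := fun k => by
    rw [pow_add, pow_two]
    simp [mul_apply_eq_comp, hv]
  have h2 : HasSum (fun k : ℕ => ((k.factorial : ℂ)⁻¹ • N ^ k) v)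
      (∑ k ∈ Finset.range 2, ((k.factorial : ℂ)⁻¹ • N ^ k) v) :=
    hasSum_sum_of_ne_finset_zero fun k hk => by
      obtain ⟨j, rfl⟩ := Nat.exists_eq_add_of_le' (not_lt.1 (mt Finset.mem_range.2 hk))
      rw [smul_apply, h0, smul_zero]
  rw [h1.unique h2]
  simp [Finset.sum_range_succ]

theorem exp_apply_eq_smul_exp_sub (L : V →L[ℂ] V) (μ : ℂ) (v : V) :
    NormedSpace.exp L v = Complex.exp μ • NormedSpace.exp (L - algebraMap ℂ (V →L[ℂ] V) μ) v := by
  let : NormedAlgebra ℚ (V →L[ℂ] V) := NormedAlgebra.restrictScalars ℚ ℂ _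
  have h : NormedSpace.exp L = NormedSpace.exp (algebraMap ℂ (V →L[ℂ] V) μ) *
      NormedSpace.exp (L - algebraMap ℂ (V →L[ℂ] V) μ) := by
    rw [← NormedSpace.exp_add_of_commute (Algebra.commutes _ _), add_sub_cancel]
  rw [h, ← NormedSpace.algebraMap_exp_comm, ← Complex.exp_eq_exp_ℂ, ← Algebra.smul_def, smul_apply]

theorem exp_apply_of_eigenvector {L : V →L[ℂ] V} {μ : ℂ} {v : V} (hv : L v = μ • v) :
    NormedSpace.exp L v = Complex.exp μ • v := by
  have h : (L - algebraMap ℂ (V →L[ℂ] V) μ) v = 0 := by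
    simp [Algebra.algebraMap_eq_smul_one, hv]
  rw [exp_apply_eq_smul_exp_sub L μ, exp_apply_of_sq_eq_zero (by rw [h, map_zero]), h, add_zero]

/-- The eigenvectors of `exp L` for a nonzero eigenvalue are sums of eigenvectors of `L`: since
`exp` has no critical points, `exp L` is no more semisimple than `L`. -/
theorem eigenspace_exp_le [FiniteDimensional ℂ V] (L : V →L[ℂ] V) {z : ℂ} (hz : z ≠ 0) :
    Module.End.eigenspace (NormedSpace.exp L : V →L[ℂ] V).toLinearMap z ≤
      ⨆ (μ : ℂ) (_ : Complex.exp μ = z), Module.End.eigenspace L.toLinearMap μ := by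
  set p := Module.End.eigenspace (NormedSpace.exp L : V →L[ℂ] V).toLinearMap z with hp
  have hmem : ∀ v, v ∈ p ↔ NormedSpace.exp L v = z • v := fun v => Module.End.mem_eigenspace_iff
  have hcomm : ∀ v, NormedSpace.exp L (L v) = L (NormedSpace.exp L v) := fun v =>
    congrArg (· v) ((Commute.refl L).exp_left).eq
  have hinv : ∀ v ∈ p, L v ∈ p := fun v hv => by
    rw [hmem] at hv ⊢
    rw [hcomm, hv, map_smul]
  have hinv' : ∀ (μ : ℂ), ∀ v ∈ p, (L.toLinearMap - μ • 1) v ∈ p := fun μ v hv =>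
    p.sub_mem (hinv v hv) (p.smul_mem μ hv)
  have hsq : ∀ (μ : ℂ), ∀ v ∈ p, (L.toLinearMap - μ • 1) ((L.toLinearMap - μ • 1) v) = 0 →
      (L.toLinearMap - μ • 1) v = 0 := by
    intro μ v hv h
    have e : ∀ u, (L - algebraMap ℂ (V →L[ℂ] V) μ) u = (L.toLinearMap - μ • 1) u := fun u => by
      simp [Algebra.algebraMap_eq_smul_one]
    -- Comparing `exp L v = exp μ • (v + w)` and `exp L w = exp μ • w` with multiplication by `z`.
    set w := (L.toLinearMap - μ • 1) v with hw
    have h1 := exp_apply_eq_smul_exp_sub L μ v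
    have h2 := exp_apply_eq_smul_exp_sub L μ w
    rw [exp_apply_of_sq_eq_zero (N := L - algebraMap ℂ (V →L[ℂ] V) μ) (by rw [e, e, h]), e,
      (hmem v).1 hv, ← hw] at h1
    rw [exp_apply_of_sq_eq_zero (N := L - algebraMap ℂ (V →L[ℂ] V) μ) (by rw [e w, h, map_zero]),
      e, h, add_zero, (hmem w).1 (hinv' μ v hv)] at h2
    by_contra hw0
    have hzμ := smul_left_injective ℂ hw0 h2
    rw [← hzμ, smul_add, left_eq_add] at h1
    exact hw0 ((smul_eq_zero.1 h1).resolve_left hz)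
  have hpow : ∀ (μ : ℂ) (k : ℕ), ∀ v ∈ p, ((L.toLinearMap - μ • 1) ^ k) v = 0 →
      (L.toLinearMap - μ • 1) v = 0 := by
    intro μ k
    induction k with
    | zero => intro v _ h; rw [pow_zero] at h; rw [show v = 0 from h, map_zero]
    | succ k ih =>
      intro v hv h
      rw [pow_succ] at h
      exact hsq μ v hv (ih _ (hinv' μ v hv) h)
  have htop := Submodule.inf_iSup_genEigenspace (f := L.toLinearMap) hinv ⊤
  rw [show (⨆ μ, Module.End.genEigenspace L.toLinearMap μ ⊤) = ⊤ from
    Module.End.iSup_maxGenEigenspace_eq_top _, inf_top_eq] at htop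
  rw [htop]
  refine iSup_le fun μ v hv => ?_
  obtain ⟨hvp, hvμ⟩ := Submodule.mem_inf.1 hv
  obtain ⟨k, hk⟩ := (Module.End.mem_maxGenEigenspace _ _ _).1 hvμ
  have hLv : L v = μ • v := by
    have := hpow μ k v hvp hk
    exact sub_eq_zero.1 this
  rcases eq_or_ne v 0 with rfl | hv0
  · exact Submodule.zero_mem _
  · have hμ : Complex.exp μ = z := by
      have h := (hmem v).1 hvp
      rw [exp_apply_of_eigenvector hLv] at h
      exact smul_left_injective ℂ hv0 h
    exact Submodule.mem_iSup_of_mem μ (Submodule.mem_iSup_of_mem hμ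
      (Module.End.mem_eigenspace_iff.2 hLv))

end ContinuousLinearMap

/-- If `h X - X h = -ω X` then conjugation by `exp (-i h)` multiplies `X` by `exp (i ω)`. -/
theorem exp_mul_mul_exp_of_commutator {A : Type*} [NormedRing A] [NormedAlgebra ℂ A]
    [CompleteSpace A] {h X : A} {c : ℂ} (hX : h * X - X * h = -c • X) :
    NormedSpace.exp (-(Complex.I • h)) * X * NormedSpace.exp (Complex.I • h) =
      Complex.exp (c * Complex.I) • X := by
  let : NormedAlgebra ℚ A := NormedAlgebra.restrictScalars ℚ ℂ A
  have hs : SemiconjBy X (-(Complex.I • h) + algebraMap ℂ A (c * Complex.I))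
      (-(Complex.I • h)) := by
    have h1 : h * X = X * h - c • X := by
      rw [sub_eq_iff_eq_add'.1 hX, neg_smul, sub_eq_add_neg]
    rw [SemiconjBy, mul_add, ← Algebra.commutes, ← Algebra.smul_def, neg_mul, mul_neg,
      smul_mul_assoc, mul_smul_comm, h1, smul_sub, smul_smul, mul_comm Complex.I]
    abel
  have h2 := hs.exp_right
  rw [NormedSpace.exp_add_of_commute (Algebra.commutes _ _).symm, ← NormedSpace.algebraMap_exp_comm,
    ← Complex.exp_eq_exp_ℂ, SemiconjBy, ← Algebra.commutes, ← Algebra.smul_def, mul_smul_comm] at h2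
  rw [← h2, smul_mul_assoc, mul_assoc,
    ← NormedSpace.exp_add_of_commute ((Commute.refl (Complex.I • h)).neg_left), neg_add_cancel,
    NormedSpace.exp_zero, mul_one]

end Exponential

/-! ### From matrices to operators -/

section Operators

variable {H : Type*} [NormedAddCommGroup H] [InnerProductSpace ℂ H] [CompleteSpace H]
  [FiniteDimensional ℂ H]

/-- The identification of operators with matrices given by an orthonormal basis. -/
noncomputable def operatorMatrixEquiv (H : Type*) [NormedAddCommGroup H] [InnerProductSpace ℂ H]
    [CompleteSpace H] [FiniteDimensional ℂ H] :
    (H →L[ℂ] H) ≃⋆ₐ[ℂ] Matrix (Fin (Module.finrank ℂ H)) (Fin (Module.finrank ℂ H)) ℂ :=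
  (stdOrthonormalBasis ℂ H).repr.conjStarAlgEquiv.trans Matrix.toEuclideanCLM.symm

/-- On its eigenvectors with purely imaginary eigenvalues, a GKLS generator is the commutator
`-i [h, ·]` with a self-adjoint operator `h`. In general `h` is not the Hamiltonian `K` of the given
GKLS form: `K` may also act on the part of the space that carries the decohering dynamics. -/
theorem IsGKLSGenerator.exists_isSelfAdjoint_commutator {L : (H →L[ℂ] H) →L[ℂ] (H →L[ℂ] H)}
    (hL : IsGKLSGenerator L) :
    ∃ h : H →L[ℂ] H, IsSelfAdjoint h ∧ ∀ (ω : ℝ) (X : H →L[ℂ] H),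
      L X = (ω * Complex.I) • X → h * X - X * h = -(ω : ℂ) • X := by
  obtain ⟨K, m, A, hK, hLX⟩ := hL
  set e := operatorMatrixEquiv H
  set B : H →L[ℂ] H := ∑ j, star (A j) * A j with hB
  have hBs : star B = B := by simp [hB, star_sum]
  set G : H →L[ℂ] H := -(Complex.I • K) - (1 / 2 : ℂ) • B with hG
  have hGs : star G = Complex.I • K - (1 / 2 : ℂ) • B := by
    simp [hG, hBs, hK.star_eq, star_smul]
  have hgkls : ∀ X, Matrix.gkls (e G) (fun j => e (A j)) (e X) = e (L X) := by
    intro X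
    have : L X = G * X + X * star G + ∑ j, A j * X * star (A j) := by
      rw [hLX, hGs, hG, Finset.sum_sub_distrib, ← Finset.smul_sum, Finset.sum_add_distrib,
        ← Finset.sum_mul, ← Finset.mul_sum, ← hB]
      simp only [sub_mul, mul_sub, neg_mul, smul_mul_assoc, mul_smul_comm, smul_add, smul_sub]
      abel
    rw [this, Matrix.gkls]
    simp only [map_add, map_mul, map_sum, map_star, Matrix.star_eq_conjTranspose]
  have h0 : e G + (e G).conjTranspose + ∑ j, (e (A j)).conjTranspose * e (A j) = 0 := by
    have : G + star G + ∑ j, star (A j) * A j = 0 := by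
      rw [hGs, hG, ← hB]
      module
    simpa only [map_add, map_mul, map_sum, map_star, Matrix.star_eq_conjTranspose, map_zero]
      using congrArg e this
  obtain ⟨h, hh, hcomm⟩ := Matrix.exists_hermitian_of_gkls h0
  refine ⟨e.symm h, ?_, fun ω X hX => ?_⟩
  · rw [IsSelfAdjoint, ← map_star, Matrix.star_eq_conjTranspose, hh.eq]
  · have := hcomm ω (e X) (by rw [hgkls, hX, map_smul])
    apply e.injective
    calc e (e.symm h * X - X * e.symm h) = h * e X - e X * h := by
          rw [map_sub, map_mul, map_mul, StarAlgEquiv.apply_symm_apply]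
      _ = e (-(ω : ℂ) • X) := by rw [this, map_smul]

end Operators

theorem mainTheorem2 {H : Type*} [NormedAddCommGroup H] [InnerProductSpace ℂ H] [CompleteSpace H]
    [FiniteDimensional ℂ H] (Φ : QuantumChannel H) :
    ((∃ L : (H →L[ℂ] H) →L[ℂ] (H →L[ℂ] H), IsGKLSGenerator L ∧
        ∀ X : H →L[ℂ] H, Φ.toLinearMap X = NormedSpace.exp L X) →
      ∃ U ∈ unitary (H →L[ℂ] H), ∀ X : Φ.attractor,
        (Φ.peripheralMap X : H →L[ℂ] H) = U * (X : H →L[ℂ] H) * star U) ∧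
    ((Φ.toLinearMap ∘ₗ Φ.toLinearMap = Φ.toLinearMap) →
      ∃ U ∈ unitary (H →L[ℂ] H), ∀ X : Φ.attractor,
        (Φ.peripheralMap X : H →L[ℂ] H) = U * (X : H →L[ℂ] H) * star U) := by
  constructor
  · rintro ⟨L, hL, hΦ⟩
    obtain ⟨h, hh, hcomm⟩ := hL.exists_isSelfAdjoint_commutator
    let : NormedAlgebra ℚ (H →L[ℂ] H) := NormedAlgebra.restrictScalars ℚ ℂ _
    set U : H →L[ℂ] H := NormedSpace.exp (-(Complex.I • h)) with hU
    have hUs : star U = NormedSpace.exp (Complex.I • h) := by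
      rw [hU, NormedSpace.star_exp]
      congr 1
      simp [star_smul, hh.star_eq]
    refine ⟨U, NormedSpace.exp_mem_unitary_of_mem_skewAdjoint ?_, fun X => ?_⟩
    · rw [skewAdjoint.mem_iff]
      simp [star_smul, hh.star_eq]
    have hΦL : Φ.toLinearMap = (NormedSpace.exp L).toLinearMap := LinearMap.ext hΦ
    have key : Φ.attractor ≤ LinearMap.eqLocus Φ.toLinearMap
        (LinearMap.mulRight ℂ (star U) ∘ₗ LinearMap.mulLeft ℂ U) := by
      refine iSup₂_le fun z hz => ?_
      have hz0 : z ≠ 0 := by rintro rfl; simp at hz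
      rw [hΦL]
      refine (ContinuousLinearMap.eigenspace_exp_le L hz0).trans (iSup₂_le fun μ hμ Y hY => ?_)
      have hLY : L Y = μ • Y := Module.End.mem_eigenspace_iff.1 hY
      -- the eigenvalue has modulus one, so its logarithm is purely imaginary
      have hre : μ.re = 0 := by
        rw [← hμ, Complex.norm_exp, Real.exp_eq_one_iff] at hz
        exact hz
      have hμ' : μ = μ.im * Complex.I := by
        rw [← Complex.re_add_im μ, hre]; simp
      rw [LinearMap.mem_eqLocus]
      change NormedSpace.exp L Y = U * Y * star U
      rw [ContinuousLinearMap.exp_apply_of_eigenvector hLY, hUs, hU,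
        exp_mul_mul_exp_of_commutator (hcomm μ.im Y (by rw [← hμ', hLY])), ← hμ']
    exact key X.2
  · intro hΦ
    refine ⟨1, one_mem _, fun X => ?_⟩
    -- an idempotent has no nonzero eigenvalue other than one
    have key : Φ.attractor ≤ LinearMap.eqLocus Φ.toLinearMap LinearMap.id := by
      refine iSup₂_le fun z hz Y hY => ?_
      have hY' : Φ.toLinearMap Y = z • Y := Module.End.mem_eigenspace_iff.1 hY
      have hz0 : z ≠ 0 := by rintro rfl; simp at hz
      have h := LinearMap.congr_fun hΦ Y
      rw [LinearMap.comp_apply, hY', map_smul, hY'] at h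
      rw [LinearMap.mem_eqLocus, LinearMap.id_apply, hY']
      exact smul_right_injective _ hz0 h
    rw [star_one, mul_one, one_mul]
    exact key X.2
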